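/- Definitions. Graphs are simple and undirected on the node set $[n]$; $N_i^G$ is the neighborhood of node $i$. Two graphs are node neighbors if they differ only in edges incident to one node. A (noninteractive, unrestricted) local algorithm $\mathcal A$ consists of a distribution of public random strings $\rho$, local randomizers $\mathcal R_{1,\rho},\dots,\mathcal R_{n,\rho}$ (with independent private randomness), and a postprocessing algorithm $\mathcal P$; on input $G$ it outputs $\mathcal P(\mathcal R_{1,\rho}(N_1^G),\dots,\mathcal R_{n,\rho}(N_n^G))$. It is $(\varepsilon,\delta)$-LNDP if for every public string $\rho$, all node-neighboring $G,G'$ and all measurable sets $E$ of tuples of reports, $\Pr[\vec{\mathcal R}_\rho(G)\in E]\le e^{\varepsilon}\Pr[\vec{\mathcal R}_\rho(G')\in E]+\delta$. A graph is $t$-starpartite if there is a set $T$ of $t$ nodes such that its edges are exactly the pairs of distinct nodes that meet $T$. Let $\mathcal G^{\mathrm{star}}_{n,t}$ and $\mathcal G^{\mathrm{reg}}_{n,t}$ be the uniform distributions on $t$-starpartite and on $t$-regular graphs on $[n]$. Theorem. There are absolute constants $C,c>0$ such that for all $\varepsilon\in(0,\tfrac12)$ and $\delta\in(0,\tfrac1{10})$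 there is an integer $t\ge 1$ with $t\le C\,\ln^5(1/\delta)/\varepsilon^6$ such that for every integer $n\ge c\,\ln^{10}(1/\delta)/\varepsilon^{10}$ both graph classes are nonempty and there is an unrestricted $(\varepsilon,\delta)$-LNDP algorithm $\mathcal A$ with outputs "starpartite" and "regular" satisfying $$\Pr_{G\sim \mathcal G^{\mathrm{star}}_{n,t}}[\mathcal A(G)=\text{"starpartite"}]\ge \tfrac23\quad\text{and}\quad \Pr_{G\sim \mathcal G^{\mathrm{reg}}_{n,t}}[\mathcal A(G)=\text{"regular"}]\ge \tfrac23 .$$ Moreover, $\mathcal A$ can be taken of the following form, for some $s\in\mathbb N$, $\sigma>0$, $\tau\in\mathbb R$. The public randomness determines random multisets $S_1,\dots,S_s$, each of which is distributed as $\lfloor n/t\rfloor$ uniformly random nodes drawn with replacement (the $S_j$ need not be mutually independent). Node $i$ reports the noisy bits $a_{i,j}=\mathbf 1[N_i^G\cap S_j\ne\varnothing]+Z_{i,j}$ for $j=1,\dots,s$, with independent $Z_{i,j}\sim\mathcal N(0,\sigma^2)$. The output is "regular" if the fraction of $j\in\{1,\dots,s\}$ with $\frac1n\sum_{i}a_{i,j}\in[0,1]$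 is at least $\tau$, and "starpartite" otherwise. -/

import Mathlib

open MeasureTheory ProbabilityTheory
open scoped ENNReal NNReal

namespace LNDP

/-- Two laws on the same outcome space are `(ε, δ)`-indistinguishable. -/
def Indistinguishable {Y : Type*} [MeasurableSpace Y] (ε δ : ℝ) (P Q : Measure Y) : Prop :=
  ∀ E : Set Y, MeasurableSet E →
    P E ≤ ENNReal.ofReal (Real.exp ε) * Q E + ENNReal.ofReal δ ∧
      Q E ≤ ENNReal.ofReal (Real.exp ε) * P E + ENNReal.ofReal δ

/-- Two graphs on the same node set are node neighbors if they differ only in the edges incident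
to some single node. -/
def NodeNeighbors {n : ℕ} (G G' : SimpleGraph (Fin n)) : Prop :=
  ∃ i : Fin n, ∀ u v : Fin n, u ≠ i → v ≠ i → (G.Adj u v ↔ G'.Adj u v)

/-- A noninteractive local algorithm on graphs with node set `Fin n` (nodes see their entire
neighborhoods): public randomness `ρ ∼ pubLaw`; for each node `i` a local randomizer, where
`randomizer i N ρ` is the law of the message of node `i` when its neighborhood is `N` and the public
string is `ρ`; and a (possibly randomized) postprocessing of the `n` messages. -/
structure LocalAlgorithm (n : ℕ) (Out : Type) [MeasurableSpace Out] where
  Pub : Type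
  Msg : Type
  [pubMeas : MeasurableSpace Pub]
  [msgMeas : MeasurableSpace Msg]
  pubLaw : Measure Pub
  [pubProb : IsProbabilityMeasure pubLaw]
  randomizer : Fin n → Set (Fin n) → Kernel Pub Msg
  [randomizerMarkov : ∀ i N, IsMarkovKernel (randomizer i N)]
  post : Kernel (Fin n → Msg) Out
  [postMarkov : IsMarkovKernel post]

attribute [instance] LocalAlgorithm.pubMeas LocalAlgorithm.msgMeas LocalAlgorithm.pubProb
  LocalAlgorithm.randomizerMarkov LocalAlgorithm.postMarkov

namespace LocalAlgorithm

variable {n : ℕ} {Out : Type} [MeasurableSpace Out]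

/-- The joint law of the messages of all nodes on input `G`, for a fixed public string `ρ`; the
nodes use independent private coins. -/
noncomputable def reportLaw (A : LocalAlgorithm n Out) (ρ : A.Pub) (G : SimpleGraph (Fin n)) :
    Measure (Fin n → A.Msg) :=
  Measure.pi fun i => A.randomizer i (G.neighborSet i) ρ

/-- The probability that the output of the algorithm on input `G` lies in `E`. -/
noncomputable def outputProb (A : LocalAlgorithm n Out) (G : SimpleGraph (Fin n)) (E : Set Out) :
    ℝ≥0∞ :=
  ∫⁻ ρ, ∫⁻ z, A.post z E ∂(A.reportLaw ρ G) ∂A.pubLaw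

/-- Noninteractive local node differential privacy: for every public string, the joint reports on
node-neighboring graphs are `(ε, δ)`-indistinguishable. -/
def IsLNDP (A : LocalAlgorithm n Out) (ε δ : ℝ) : Prop :=
  ∀ G G' : SimpleGraph (Fin n), NodeNeighbors G G' →
    ∀ ρ : A.Pub, Indistinguishable ε δ (A.reportLaw ρ G) (A.reportLaw ρ G')

end LocalAlgorithm

/-- The starpartite graph with center `T`: two distinct nodes are adjacent iff at least one of them
lies in `T`. -/
def starGraph {n : ℕ} (T : Finset (Fin n)) : SimpleGraph (Fin n) :=
  SimpleGraph.fromRel fun i _ => i ∈ T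

/-- The set of `t`-starpartite graphs on `n` nodes. -/
def starpartiteGraphs (n t : ℕ) : Set (SimpleGraph (Fin n)) :=
  {G | ∃ T : Finset (Fin n), T.card = t ∧ G = starGraph T}

open Classical in
/-- The set of `t`-regular graphs on `n` nodes. -/
def regularGraphs (n t : ℕ) : Set (SimpleGraph (Fin n)) :=
  {G | G.IsRegularOfDegree t}

/-- The average of `f G` over a uniformly random graph `G` in `S`. It is `0` if `S` is empty, so a
positive lower bound on it includes that `S` is nonempty. -/
noncomputable def uniformAverage {n : ℕ} (S : Set (SimpleGraph (Fin n)))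
    (f : SimpleGraph (Fin n) → ℝ≥0∞) : ℝ≥0∞ :=
  (∑ G ∈ S.toFinite.toFinset, f G) / (S.ncard : ℝ≥0∞)

/-- The two possible answers of a distinguisher. -/
inductive Verdict where
  | starpartite
  | regular

instance : MeasurableSpace Verdict := ⊤

/-- The bit "a node with neighborhood `N` has a neighbor in the multiset `{x 0, …, x (m - 1)}`". -/
noncomputable def hitBit {n m : ℕ} (N : Set (Fin n)) (x : Fin m → Fin n) : ℝ :=
  open Classical in if ∃ k, x k ∈ N then 1 else 0

/-- The law of the message of a node with neighborhood `N`, given the multisets `S`: for each `j`,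
the bit for `S j` plus independent Gaussian noise of variance `σ ^ 2`. -/
noncomputable def noisyBits {n m s : ℕ} (σ : ℝ≥0) (N : Set (Fin n)) (S : Fin s → Fin m → Fin n) :
    Measure (Fin s → ℝ) :=
  Measure.pi fun j => gaussianReal (hitBit N (S j)) (σ ^ 2)

/-- The fraction of the indices `j` for which the average over all nodes of the `j`-th noisy bit
lies in `[0, 1]`. -/
noncomputable def fractionInUnit {n s : ℕ} (a : Fin n → Fin s → ℝ) : ℝ :=
  (∑ j, (Set.Icc (0 : ℝ) 1).indicator (fun _ => (1 : ℝ)) ((∑ i, a i j) / n)) / s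

/-- The decision of the server: "regular" iff that fraction is at least `τ`. -/
noncomputable def decideVerdict {n s : ℕ} (τ : ℝ) (a : Fin n → Fin s → ℝ) : Verdict :=
  open Classical in if τ ≤ fractionInUnit a then Verdict.regular else Verdict.starpartite

theorem measurable_decideVerdict {n s : ℕ} (τ : ℝ) :
    Measurable (decideVerdict τ : (Fin n → Fin s → ℝ) → Verdict) := by
  classical
  have h : Measurable (fractionInUnit : (Fin n → Fin s → ℝ) → ℝ) := by
    unfold fractionInUnit
    refine Measurable.div_const (Finset.measurable_sum _ fun j _ => ?_) _
    exact (measurable_const.indicator measurableSet_Icc).comp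
      (Measurable.div_const (Finset.measurable_sum _ fun i _ => by fun_prop) _)
  unfold decideVerdict
  exact Measurable.ite (measurableSet_le measurable_const h) measurable_const measurable_const

/-- The algorithm in which the public randomness `ρ ∼ D` determines multisets
`S ρ 0, …, S ρ (s - 1)`, each given by a list of `m` nodes, every node sends for each of them the
noisy bit of whether it has a neighbor in it, and the server thresholds the fraction of averaged
noisy bits that lie in `[0, 1]`. -/
noncomputable def noisyBitAlgorithm {n m s : ℕ} {Pub : Type} [MeasurableSpace Pub]
    (D : Measure Pub) [IsProbabilityMeasure D] (S : Pub → Fin s → Fin m → Fin n)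
    (hS : Measurable S) (σ : ℝ≥0) (τ : ℝ) : LocalAlgorithm n Verdict where
  Pub := Pub
  Msg := Fin s → ℝ
  pubLaw := D
  randomizer _ N := ⟨fun ρ => noisyBits σ N (S ρ), (measurable_of_countable (noisyBits σ N)).comp hS⟩
  randomizerMarkov _ N := ⟨fun ρ => by
    change IsProbabilityMeasure (noisyBits σ N (S ρ))
    unfold noisyBits
    infer_instance⟩
  post := Kernel.deterministic (decideVerdict τ) (measurable_decideVerdict τ)

/-- `A` is a noisy-bit algorithm each of whose public multisets consists of `⌊n / t⌋` nodes drawn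
uniformly at random with replacement. No joint law of the multisets is prescribed. -/
def IsNoisyBitAlgorithm {n : ℕ} (t : ℕ) (A : LocalAlgorithm n Verdict) : Prop :=
  ∃ (s : ℕ) (Pub : Type) (_ : MeasurableSpace Pub) (D : Measure Pub) (_ : IsProbabilityMeasure D)
    (S : Pub → Fin s → Fin (n / t) → Fin n) (hS : Measurable S) (σ : ℝ≥0) (τ : ℝ),
    0 < σ ∧
    (∀ (j : Fin s) (x : Fin (n / t) → Fin n), D {ρ | S ρ j = x} = ((n : ℝ≥0∞) ^ (n / t))⁻¹) ∧
    A = noisyBitAlgorithm D S hS σ τ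

end LNDP

/-! Fix the multisets `S j` and let `p j` be the fraction of nodes with a neighbor in `S j`. In a
starpartite graph every node outside the center `T` has neighborhood exactly `T`, so these nodes
share the same bit and `p j` is within `t / n` of `0` or `1`. In a regular graph a node is missed
with probability about `exp (-1)`, and pairs of neighborhoods overlap little on average, so `p j` is
typically near `1 - exp (-1)`.

The averaged noisy bit is Gaussian with mean `p j` and variance `v`. Its mass on `[0, 1]` is
`(2πv)^(-1/2) * (1 - ((p j - 1/2)^2 + 1/12) / (2v))` up to lower order, so it sees `(p j - 1/2)^2`:
at least `0.24` for stars, on average at most `0.2` for regular graphs outside an event of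
probability `1/4`. The gap in expected fractions is of order `v^(-3/2)`, and Chebyshev resolves it
once `s` is of order `v^3` (`fractionInUnit_deviation`, `deviation_bound_le`).

Privacy at constant `v` rests on taking the multisets disjoint. Rewiring one node then changes at
most one bit of each other node and `s` bits of its own, so the squared `ℓ²` sensitivity is at most
`n + s ≤ 2n` (`sum_hitBit_sub_sq_le`). Per-bit variance `n * V` with `V = 6 * log (1/δ) / ε^2`
suffices, and averaging over `n` nodes reduces it to `V`. Disjointness needs `s * ⌊n/t⌋ ≤ n`, whence
`s = t`, of order `V^3`. Each multiset can still be exactly uniform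
(`exists_disjoint_uniform_multisets`), and the utility analysis uses only these marginals. -/

namespace LNDP

/-! ### Rényi moments: conversion to approximate privacy, products, Gaussians. -/

section RenyiBound

variable {α : Type*} [MeasurableSpace α]

/-- `P` has a density with respect to `Q` whose moment of order `1 + l` is at most `exp b`. -/
def RenyiBound (l b : ℝ) (P Q : Measure α) : Prop :=
  ∃ f : α → ℝ≥0∞, Measurable f ∧ P = Q.withDensity f ∧
    ∫⁻ x, f x ^ (1 + l) ∂Q ≤ ENNReal.ofReal (Real.exp b)

/-- Markov's inequality in pointwise form: with `K = exp ε`, either `f ≤ K` or `f ≤ f ^ (1 + l) * K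
^ (-l)`. Integrating the second term gives at most `exp (b - l * ε) ≤ δ`. -/
theorem RenyiBound.measure_le {l b ε δ : ℝ} {P Q : Measure α} (hl : 0 < l) (hδ : 0 < δ)
    (hb : b ≤ l * ε - Real.log (1 / δ)) (h : RenyiBound l b P Q) {E : Set α}
    (hE : MeasurableSet E) :
    P E ≤ ENNReal.ofReal (Real.exp ε) * Q E + ENNReal.ofReal δ := by
  obtain ⟨f, hf, rfl, hfb⟩ := h
  set K := ENNReal.ofReal (Real.exp ε) with hK
  have hK0 : K ≠ 0 := by simp [hK, Real.exp_pos]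
  have hKt : K ≠ ∞ := ENNReal.ofReal_ne_top
  have hpt : ∀ x, f x ≤ K + f x ^ (1 + l) * ENNReal.ofReal (Real.exp (-(l * ε))) := by
    intro x
    rcases le_total (f x) K with hx | hx
    · exact hx.trans le_self_add
    · refine le_trans ?_ le_add_self
      have h1 : K ^ l ≤ f x ^ l := ENNReal.rpow_le_rpow hx hl.le
      have h2 : K ^ l = ENNReal.ofReal (Real.exp (l * ε)) := by
        rw [hK, ENNReal.ofReal_rpow_of_pos (Real.exp_pos _), ← Real.exp_mul, mul_comm]
      have h3 : K ^ l * ENNReal.ofReal (Real.exp (-(l * ε))) = 1 := by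
        rw [h2, ← ENNReal.ofReal_mul (Real.exp_pos _).le, ← Real.exp_add]
        simp
      rw [ENNReal.rpow_add_of_nonneg _ _ zero_le_one hl.le, ENNReal.rpow_one, mul_assoc]
      calc f x = f x * (K ^ l * ENNReal.ofReal (Real.exp (-(l * ε)))) := by rw [h3, mul_one]
        _ ≤ _ := by gcongr
  have hm : Measurable fun x => f x ^ (1 + l) := hf.pow_const _
  calc Q.withDensity f E = ∫⁻ x in E, f x ∂Q := withDensity_apply _ hE
    _ ≤ ∫⁻ x in E, (K + f x ^ (1 + l) * ENNReal.ofReal (Real.exp (-(l * ε)))) ∂Q :=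
        lintegral_mono hpt
    _ = K * Q E + (∫⁻ x in E, f x ^ (1 + l) ∂Q) * ENNReal.ofReal (Real.exp (-(l * ε))) := by
        rw [lintegral_add_left measurable_const, lintegral_mul_const _ hm]
        simp
    _ ≤ K * Q E + ENNReal.ofReal (Real.exp b) * ENNReal.ofReal (Real.exp (-(l * ε))) := by
        gcongr
        exact (setLIntegral_le_lintegral _ _).trans hfb
    _ ≤ K * Q E + ENNReal.ofReal δ := by
        gcongr
        rw [← ENNReal.ofReal_mul (Real.exp_pos _).le, ← Real.exp_add]
        refine ENNReal.ofReal_le_ofReal ?_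
        rw [← Real.le_log_iff_exp_le hδ]
        rw [one_div, Real.log_inv] at hb
        linarith

theorem lintegral_pi_prod {ι : Type*} [Fintype ι] {β : ι → Type*} [∀ i, MeasurableSpace (β i)]
    (Q : ∀ i, Measure (β i)) [∀ i, IsProbabilityMeasure (Q i)] {g : ∀ i, β i → ℝ≥0∞}
    (hg : ∀ i, Measurable (g i)) :
    ∫⁻ z, ∏ i, g i (z i) ∂Measure.pi Q = ∏ i, ∫⁻ x, g i x ∂Q i := by
  have hX := iIndepFun_pi (μ := Q) fun i => (hg i).aemeasurable
  rw [lintegral_prod_eq_prod_lintegral_of_indepFun Finset.univ _ hX fun i => by fun_prop]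
  exact Finset.prod_congr rfl fun i _ =>
    (measurePreserving_eval Q i).lintegral_comp (hg i)

theorem RenyiBound.pi {ι : Type*} [Fintype ι] {β : ι → Type*} [∀ i, MeasurableSpace (β i)]
    {P Q : ∀ i, Measure (β i)} [∀ i, IsProbabilityMeasure (P i)]
    [∀ i, IsProbabilityMeasure (Q i)] {l : ℝ} (hl : 0 < l) {b : ι → ℝ}
    (h : ∀ i, RenyiBound l (b i) (P i) (Q i)) :
    RenyiBound l (∑ i, b i) (Measure.pi P) (Measure.pi Q) := by
  choose f hf hP hb using h
  have hfm : ∀ i, Measurable fun z : ∀ i, β i => f i (z i) :=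
    fun i => (hf i).comp (measurable_pi_apply i)
  refine ⟨fun z => ∏ i, f i (z i), Finset.measurable_prod _ fun i _ => hfm i, ?_, ?_⟩
  · refine Measure.pi_eq fun s hs => ?_
    rw [withDensity_apply _ (MeasurableSet.univ_pi hs), ← lintegral_indicator
      (MeasurableSet.univ_pi hs)]
    have : ∀ z : ∀ i, β i, (Set.univ.pi s).indicator (fun z => ∏ i, f i (z i)) z
        = ∏ i, (s i).indicator (f i) (z i) := by
      intro z
      by_cases hz : z ∈ Set.univ.pi s
      · rw [Set.indicator_of_mem hz]
        exact Finset.prod_congr rfl fun i _ => (Set.indicator_of_mem (hz i trivial) _).symm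
      · rw [Set.indicator_of_notMem hz]
        simp only [Set.mem_univ_pi, not_forall] at hz
        obtain ⟨i, hi⟩ := hz
        exact (Finset.prod_eq_zero (Finset.mem_univ i) (Set.indicator_of_notMem hi _)).symm
    simp_rw [this]
    rw [lintegral_pi_prod Q fun i => (hf i).indicator (hs i)]
    refine Finset.prod_congr rfl fun i _ => ?_
    rw [lintegral_indicator (hs i), hP i, withDensity_apply _ (hs i)]
  · have : ∀ z : ∀ i, β i, (∏ i, f i (z i)) ^ (1 + l) = ∏ i, f i (z i) ^ (1 + l) := fun z =>
      (ENNReal.prod_rpow_of_nonneg (by linarith)).symm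
    simp_rw [this]
    rw [lintegral_pi_prod Q fun i => (hf i).pow_const _, Real.exp_sum,
      ENNReal.ofReal_prod_of_nonneg fun i _ => (Real.exp_pos _).le]
    exact Finset.prod_le_prod' fun i _ => hb i

/-- The likelihood ratio is the exponential of an affine function, so its moment is a value of the
Gaussian moment generating function and the bound is an equality. -/
theorem renyiBound_gaussianReal (x y l : ℝ) {v : ℝ≥0} (hv : v ≠ 0) :
    RenyiBound l ((1 + l) * l * (x - y) ^ 2 / (2 * v)) (gaussianReal x v) (gaussianReal y v) := by
  have hv' : (v : ℝ) ≠ 0 := by exact_mod_cast hv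
  have hm : Measurable fun z : ℝ =>
      ENNReal.ofReal (Real.exp (((x - y) * z + (y ^ 2 - x ^ 2) / 2) / v)) := by fun_prop
  refine ⟨_, hm, ?_, ?_⟩
  · rw [gaussianReal_of_var_ne_zero _ hv, gaussianReal_of_var_ne_zero _ hv,
      ← withDensity_mul _ (measurable_gaussianPDF y v) hm]
    congr 1
    ext z
    rw [Pi.mul_apply, gaussianPDF, gaussianPDF, ← ENNReal.ofReal_mul (gaussianPDFReal_nonneg _ _ _),
      gaussianPDFReal, gaussianPDFReal, mul_assoc (√(2 * Real.pi * v))⁻¹, ← Real.exp_add]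
    congr 3
    field_simp
    ring
  · have h1 : ∀ z : ℝ, ENNReal.ofReal (Real.exp (((x - y) * z + (y ^ 2 - x ^ 2) / 2) / v)) ^ (1 + l)
        = ENNReal.ofReal (Real.exp ((1 + l) * ((y ^ 2 - x ^ 2) / 2) / v) *
          Real.exp ((1 + l) * (x - y) / v * z)) := by
      intro z
      rw [ENNReal.ofReal_rpow_of_pos (Real.exp_pos _), ← Real.exp_mul, ← Real.exp_add]
      congr 2
      field_simp
      ring
    simp_rw [h1]
    have hi := (integrable_exp_mul_gaussianReal (μ := y) (v := v) ((1 + l) * (x - y) / v))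
    rw [← ofReal_integral_eq_lintegral_ofReal (hi.const_mul _)
      (Filter.Eventually.of_forall fun z => by positivity), integral_const_mul]
    have h2 : ∫ z, Real.exp ((1 + l) * (x - y) / v * z) ∂gaussianReal y v
        = Real.exp (y * ((1 + l) * (x - y) / v) + v * ((1 + l) * (x - y) / v) ^ 2 / 2) :=
      congrFun (mgf_id_gaussianReal (μ := y) (v := v)) _
    rw [h2, ← Real.exp_add]
    refine le_of_eq ?_
    congr 2
    field_simp
    ring

end RenyiBound

end LNDP

/-! ### Sensitivity and privacy of the noisy bits. -/

namespace LNDP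

theorem hitBit_eq_zero_or_one {n m : ℕ} (N : Set (Fin n)) (x : Fin m → Fin n) :
    hitBit N x = 0 ∨ hitBit N x = 1 := by
  unfold hitBit
  split_ifs <;> simp

theorem hitBit_sub_sq_le_one {n m : ℕ} (N N' : Set (Fin n)) (x : Fin m → Fin n) :
    (hitBit N x - hitBit N' x) ^ 2 ≤ 1 := by
  rcases hitBit_eq_zero_or_one N x with h | h <;> rcases hitBit_eq_zero_or_one N' x with h' | h' <;>
    norm_num [h, h']

theorem hitBit_congr {n m : ℕ} {N N' : Set (Fin n)} {x : Fin m → Fin n}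
    (h : ∀ k, x k ∈ N ↔ x k ∈ N') : hitBit N x = hitBit N' x := by
  unfold hitBit
  classical exact if_congr (exists_congr h) rfl rfl

/-- The noisy bits have squared `ℓ²` sensitivity at most `n + s` if the multisets are disjoint. -/
theorem sum_hitBit_sub_sq_le {n m s : ℕ} {G G' : SimpleGraph (Fin n)} (h : NodeNeighbors G G')
    {S : Fin s → Fin m → Fin n} (hS : ∀ j j' k k', S j k = S j' k' → j = j') :
    ∑ i, ∑ j, (hitBit (G.neighborSet i) (S j) - hitBit (G'.neighborSet i) (S j)) ^ 2
      ≤ (n + s : ℝ) := by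
  classical
  obtain ⟨v, hv⟩ := h
  -- For `i ≠ v` the two neighborhoods differ at most in `v`, so only a multiset containing `v`
  -- matters, and disjointness allows at most one.
  have key : ∀ i, ∑ j, (hitBit (G.neighborSet i) (S j) - hitBit (G'.neighborSet i) (S j)) ^ 2
      ≤ 1 + if i = v then (s : ℝ) else 0 := by
    intro i
    by_cases hi : i = v
    · calc _ ≤ ∑ _j : Fin s, (1 : ℝ) := Finset.sum_le_sum fun j _ => hitBit_sub_sq_le_one _ _ _
        _ ≤ _ := by simp [hi]
    · calc _ ≤ ∑ j : Fin s, if ∃ k, S j k = v then (1 : ℝ) else 0 := by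
            refine Finset.sum_le_sum fun j _ => ?_
            split_ifs with hj
            · exact hitBit_sub_sq_le_one _ _ _
            · rw [hitBit_congr (N' := G'.neighborSet i) fun k => ?_]
              · simp
              · exact hv i _ hi fun hk => hj ⟨k, hk⟩
        _ = ((Finset.univ.filter fun j => ∃ k, S j k = v).card : ℝ) := by simp
        _ ≤ 1 := by
            have : (Finset.univ.filter fun j => ∃ k, S j k = v).card ≤ 1 := by
              refine Finset.card_le_one.2 fun j hj j' hj' => ?_
              simp only [Finset.mem_filter, Finset.mem_univ, true_and] at hj hj'
              obtain ⟨k, hk⟩ := hj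
              obtain ⟨k', hk'⟩ := hj'
              exact hS j j' k k' (hk.trans hk'.symm)
            exact_mod_cast this
        _ ≤ _ := by simp [hi]
  refine (Finset.sum_le_sum fun i _ => key i).trans ?_
  rw [Finset.sum_add_distrib]
  simp

theorem isLNDP_noisyBitAlgorithm {n m s : ℕ} {Pub : Type} [MeasurableSpace Pub]
    (D : Measure Pub) [IsProbabilityMeasure D] {S : Pub → Fin s → Fin m → Fin n}
    (hS : Measurable S) {σ : ℝ≥0} (τ : ℝ) (hdisj : ∀ ρ j j' k k', S ρ j k = S ρ j' k' → j = j')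
    {ε δ : ℝ} (hε : 0 < ε) (hε1 : ε ≤ 1) (hδ : 0 < δ) (hL : 1 ≤ Real.log (1 / δ)) (hsn : s ≤ n)
    (hσ0 : 0 < σ) (hσ : 6 * n * Real.log (1 / δ) ≤ ε ^ 2 * (σ : ℝ) ^ 2) :
    (noisyBitAlgorithm D S hS σ τ).IsLNDP ε δ := by
  have main : ∀ G G' : SimpleGraph (Fin n), NodeNeighbors G G' → ∀ (ρ : Pub)
      (E : Set (Fin n → Fin s → ℝ)), MeasurableSet E →
      Measure.pi (fun i => noisyBits σ (G.neighborSet i) (S ρ)) E ≤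
        ENNReal.ofReal (Real.exp ε) *
          Measure.pi (fun i => noisyBits σ (G'.neighborSet i) (S ρ)) E + ENNReal.ofReal δ := by
    intro G G' h ρ E hE
    set L := Real.log (1 / δ) with hLdef
    -- With `l = 2L/ε` the target `l * ε - L` equals `l * ε / 2`. As `(1 + l) * ε ≤ 3 * L` and the
    -- squared sensitivity is at most `2n`, the assumed noise level keeps the exponent below that.
    have hl : 0 < 2 * L / ε := by positivity
    have hv : σ ^ 2 ≠ 0 := pow_ne_zero _ hσ0.ne'
    have hσ0' : (0 : ℝ) < σ := hσ0
    have hR := RenyiBound.pi hl fun i : Fin n => RenyiBound.pi hl fun j : Fin s =>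
      renyiBound_gaussianReal (hitBit (G.neighborSet i) (S ρ j))
        (hitBit (G'.neighborSet i) (S ρ j)) (2 * L / ε) hv
    refine hR.measure_le hl hδ ?_ hE
    have hsum := sum_hitBit_sub_sq_le h (hdisj ρ)
    set l := 2 * L / ε with hldef
    have hsn' : (s : ℝ) ≤ n := by exact_mod_cast hsn
    have e1 : ∑ i, ∑ j, (1 + l) * l * (hitBit (G.neighborSet i) (S ρ j) -
        hitBit (G'.neighborSet i) (S ρ j)) ^ 2 / (2 * ((σ ^ 2 : ℝ≥0) : ℝ))
        = (1 + l) * l / (2 * (σ : ℝ) ^ 2) * ∑ i, ∑ j, (hitBit (G.neighborSet i) (S ρ j) -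
        hitBit (G'.neighborSet i) (S ρ j)) ^ 2 := by
      simp_rw [Finset.mul_sum]
      refine Finset.sum_congr rfl fun i _ => Finset.sum_congr rfl fun j _ => ?_
      push_cast
      ring
    rw [e1]
    have hlε : l * ε = 2 * L := by rw [hldef]; field_simp
    have h1l : (1 + l) * ε ≤ 3 * L := by rw [add_mul, hlε]; linarith
    calc (1 + l) * l / (2 * (σ : ℝ) ^ 2) * _ ≤ (1 + l) * l / (2 * (σ : ℝ) ^ 2) * (2 * n) := by
          gcongr
          linarith
      _ ≤ l * ε / 2 := by
          rw [div_mul_eq_mul_div, div_le_iff₀ (by positivity)]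
          have h2 : (1 + l) * n ≤ ε / 2 * (σ : ℝ) ^ 2 := by
            have h3 : ((1 + l) * n) * (2 * ε) ≤ (ε / 2 * (σ : ℝ) ^ 2) * (2 * ε) := by
              nlinarith [mul_le_mul_of_nonneg_right h1l (Nat.cast_nonneg (α := ℝ) n)]
            exact le_of_mul_le_mul_right h3 (by positivity)
          nlinarith [mul_le_mul_of_nonneg_left h2 hl.le]
      _ = l * ε - L := by linarith
  intro G G' h ρ E hE
  have h' : NodeNeighbors G' G := by
    obtain ⟨i, hi⟩ := h
    exact ⟨i, fun u v hu hv => (hi u v hu hv).symm⟩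
  exact ⟨main G G' h ρ E hE, main G' G h' ρ E hE⟩

end LNDP

/-! ### Disjoint multisets with uniform marginals. -/

namespace LNDP

/-- There is room for `s` disjoint copies of the range of `x`; each injection onto a copy extends to
a permutation. Permutations preserve the pattern of repetitions in `x`, as drawing with replacement
requires. -/
theorem exists_perms_disjoint_images {n m s : ℕ} (h : s * m ≤ n) (x : Fin m → Fin n) :
    ∃ p : Fin s → Equiv.Perm (Fin n), ∀ j j' k k', p j (x k) = p j' (x k') → j = j' := by
  classical
  have hR : Fintype.card (Set.range x) ≤ m := by
    simpa using Fintype.card_range_le x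
  have hc : Fintype.card (Fin s × Set.range x) ≤ Fintype.card (Fin n) := by
    rw [Fintype.card_prod, Fintype.card_fin, Fintype.card_fin]
    exact (Nat.mul_le_mul_left s hR).trans h
  obtain ⟨e⟩ := Function.Embedding.nonempty_of_card_le hc
  have hinj : ∀ j, Function.Injective fun r : Set.range x => e (j, r) := fun j r r' hr => by
    simpa using e.injective hr
  let q : ∀ j : Fin s, Set.range x ≃ Set.range fun r : Set.range x => e (j, r) :=
    fun j => Equiv.ofInjective _ (hinj j)
  refine ⟨fun j => (q j).extendSubtype, fun j j' k k' hk => ?_⟩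
  rw [Equiv.extendSubtype_apply_of_mem (q j) _ (Set.mem_range_self k),
    Equiv.extendSubtype_apply_of_mem (q j') _ (Set.mem_range_self k')] at hk
  exact congrArg Prod.fst (e.injective hk)

/-- Disjoint multisets, each consisting of `m` uniformly random nodes drawn with replacement: a
random word `x`, moved to disjoint places and then shuffled by a common random permutation. -/
theorem exists_disjoint_uniform_multisets {n m s : ℕ} (hn : 0 < n) (h : s * m ≤ n) :
    ∃ (Pub : Type) (_ : MeasurableSpace Pub) (D : Measure Pub) (S : Pub → Fin s → Fin m → Fin n),
      IsProbabilityMeasure D ∧ Measurable S ∧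
      (∀ ρ j j' k k', S ρ j k = S ρ j' k' → j = j') ∧
      ∀ j x, D {ρ | S ρ j = x} = ((n : ℝ≥0∞) ^ m)⁻¹ := by
  classical
  have : Nonempty (Fin n) := ⟨⟨0, hn⟩⟩
  choose p hp using exists_perms_disjoint_images (n := n) (m := m) (s := s) h
  let _ : MeasurableSpace ((Fin m → Fin n) × Equiv.Perm (Fin n)) := ⊤
  refine ⟨_, inferInstance, (PMF.uniformOfFintype ((Fin m → Fin n) × Equiv.Perm (Fin n))).toMeasure,
    fun ρ j k => ρ.2 (p ρ.1 j (ρ.1 k)), inferInstance, measurable_from_top, ?_, ?_⟩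
  · intro ρ j j' k k' hk
    exact hp ρ.1 j j' k k' (ρ.2.injective hk)
  · intro j y
    let E : Set ((Fin m → Fin n) × Equiv.Perm (Fin n)) :=
      {ρ | (fun k => ρ.2 (p ρ.1 j (ρ.1 k))) = y}
    -- A pair `(x, π)` sending `x` to `y` is determined by the composite of `p x j` and `π`, which
    -- may be any permutation and recovers `x` from `y`. So every `y` has exactly `n!` preimages,
    -- although `p` depends on `x`.
    let e : E ≃ Equiv.Perm (Fin n) :=
      { toFun := fun ρ => (p ρ.1.1 j).trans ρ.1.2
        invFun := fun π => ⟨(fun k => π.symm (y k), (p (fun k => π.symm (y k)) j).symm.trans π),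
          by ext k; simp⟩
        left_inv := by
          rintro ⟨⟨x, π⟩, hρ⟩
          have hx : (fun k => ((p x j).trans π).symm (y k)) = x := by
            ext k
            rw [← congrFun (show (fun k => π (p x j (x k))) = y from hρ) k]
            simp
          refine Subtype.ext (Prod.ext hx ?_)
          dsimp only
          rw [hx]
          ext z
          simp
        right_inv := fun π => by
          ext z
          simp }
    have hE : Fintype.card E = n.factorial := by
      rw [Fintype.card_congr e, Fintype.card_perm, Fintype.card_fin]
    have hcard := PMF.toMeasure_uniformOfFintype_apply (α := (Fin m → Fin n) × Equiv.Perm (Fin n))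
      E trivial
    refine hcard.trans ?_
    rw [hE, Fintype.card_prod, Fintype.card_perm, Fintype.card_fin, Fintype.card_fun,
      Fintype.card_fin, Fintype.card_fin, Nat.cast_mul, ENNReal.div_eq_inv_mul,
      ENNReal.mul_inv (Or.inr (ENNReal.natCast_ne_top _)) (Or.inl (ENNReal.natCast_ne_top _)),
      mul_assoc, ENNReal.inv_mul_cancel (by exact_mod_cast n.factorial_ne_zero)
      (ENNReal.natCast_ne_top _), mul_one]
    push_cast
    rfl

end LNDP

/-! ### Averaged Gaussian noise and concentration of the fraction in `[0, 1]`. -/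

namespace LNDP

theorem map_sum_pi_gaussianReal {ι : Type*} [Fintype ι] (b : ι → ℝ) (w : ℝ≥0) :
    (Measure.pi fun i => gaussianReal (b i) w).map (fun z => ∑ i, z i) =
      gaussianReal (∑ i, b i) (Fintype.card ι * w) := by
  have : IsProbabilityMeasure
      ((Measure.pi fun i => gaussianReal (b i) w).map (fun z => ∑ i, z i)) :=
    Measure.isProbabilityMeasure_map (by fun_prop)
  refine Measure.ext_of_charFun ?_
  rw [charFun_map_sum_pi_eq_prod]
  ext t
  simp_rw [Finset.prod_apply, charFun_gaussianReal]
  rw [← Complex.exp_sum]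
  congr 1
  rw [Finset.sum_sub_distrib, Finset.sum_const, Finset.card_univ, nsmul_eq_mul]
  push_cast
  rw [Finset.mul_sum, Finset.sum_mul]
  ring

variable {n s : ℕ}

theorem map_average_pi_pi_gaussianReal (hn : 0 < n) (b : Fin n → Fin s → ℝ) (w : ℝ≥0) (j : Fin s) :
    (Measure.pi fun i => Measure.pi fun j => gaussianReal (b i j) w).map
      (fun a => (∑ i, a i j) / (n : ℝ)) = gaussianReal ((∑ i, b i j) / n) (w / n) := by
  have h1 : (Measure.pi fun i => Measure.pi fun j => gaussianReal (b i j) w).map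
      (fun a i => a i j) = Measure.pi fun i => gaussianReal (b i j) w := by
    rw [Measure.pi_map_pi (f := fun _ (z : Fin s → ℝ) => z j)
      fun i => (measurable_pi_apply j).aemeasurable]
    congr 1
    ext1 i
    exact (measurePreserving_eval (fun j => gaussianReal (b i j) w) j).map_eq
  have h2 : (fun a : Fin n → Fin s → ℝ => (∑ i, a i j) / (n : ℝ)) =
      (fun x => x / (n : ℝ)) ∘ (fun z : Fin n → ℝ => ∑ i, z i) ∘ fun a i => a i j := rfl
  rw [h2, ← Measure.map_map (by fun_prop) (by fun_prop), ← Measure.map_map (by fun_prop)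
    (by fun_prop), h1, map_sum_pi_gaussianReal, gaussianReal_map_div_const]
  congr 1
  have : (n : ℝ) ≠ 0 := by exact_mod_cast hn.ne'
  ext
  push_cast
  rw [Fintype.card_fin]
  field_simp

theorem indepFun_average_pi_pi_gaussianReal (b : Fin n → Fin s → ℝ) (w : ℝ≥0) {j j' : Fin s}
    (hj : j ≠ j') :
    IndepFun (fun a : Fin n → Fin s → ℝ => (∑ i, a i j) / (n : ℝ)) (fun a => (∑ i, a i j') / n)
      (Measure.pi fun i => Measure.pi fun j => gaussianReal (b i j) w) := by
  classical
  -- All entries of the matrix are jointly independent; distinct columns use disjoint sets of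
  -- entries.
  have h := iIndepFun_uncurry_infinitePi' (X := fun _ _ x => x)
    (fun (i : Fin n) (j : Fin s) => gaussianReal (b i j) w) (fun _ _ => measurable_id)
  simp_rw [Measure.infinitePi_eq_pi] at h
  let T : Fin s → Finset (Fin n × Fin s) := fun j => Finset.univ.image fun i => (i, j)
  have hT : ∀ j i, (i, j) ∈ T j := fun j i => Finset.mem_image_of_mem _ (Finset.mem_univ i)
  have hd : Disjoint (T j) (T j') := by
    rw [Finset.disjoint_left]
    intro p hp hp'
    simp only [T, Finset.mem_image, Finset.mem_univ, true_and] at hp hp'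
    obtain ⟨i, rfl⟩ := hp
    obtain ⟨i', hi'⟩ := hp'
    exact hj (congrArg Prod.snd hi').symm
  have h2 := h.indepFun_finset (T j) (T j') hd fun p => by fun_prop
  have hm : ∀ j, Measurable fun z : T j → ℝ => (∑ i, z ⟨(i, j), hT j i⟩) / (n : ℝ) :=
    fun j => by fun_prop
  exact h2.comp (hm j) (hm j')

/-- The mass that a Gaussian measure gives to the unit interval. -/
noncomputable def unitMass (p : ℝ) (v : ℝ≥0) : ℝ := (gaussianReal p v).real (Set.Icc 0 1)

/-- Chebyshev over the noise alone, with the bits fixed: the indicators are pairwise independent,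
each of variance at most `1/4`. -/
theorem fractionInUnit_deviation (hn : 0 < n) (hs : 0 < s) (b : Fin n → Fin s → ℝ) (w : ℝ≥0)
    {γ : ℝ} (hγ : 0 < γ) :
    (Measure.pi fun i => Measure.pi fun j => gaussianReal (b i j) w)
      {a | γ ≤ |fractionInUnit a - (∑ j, unitMass ((∑ i, b i j) / n) (w / n)) / s|} ≤
        ENNReal.ofReal (1 / (4 * s * γ ^ 2)) := by
  set M := Measure.pi fun i => Measure.pi fun j => gaussianReal (b i j) w with hM
  let g : ℝ → ℝ := (Set.Icc (0 : ℝ) 1).indicator fun _ => 1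
  have hg : Measurable g := measurable_const.indicator measurableSet_Icc
  have hg01 : ∀ x, g x ∈ Set.Icc (0 : ℝ) 1 := fun x => by
    by_cases hx : x ∈ Set.Icc (0 : ℝ) 1
    · simp [g, Set.indicator_of_mem hx]
    · simp [g, Set.indicator_of_notMem hx]
  let A : Fin s → (Fin n → Fin s → ℝ) → ℝ := fun j a => (∑ i, a i j) / n
  have hA : ∀ j, Measurable (A j) := fun j => by fun_prop
  let Y : Fin s → (Fin n → Fin s → ℝ) → ℝ := fun j a => g (A j a)
  have hY : ∀ j, Measurable (Y j) := fun j => hg.comp (hA j)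
  have hL : ∀ j, MemLp (Y j) 2 M := fun j =>
    memLp_of_bounded (Filter.Eventually.of_forall fun a => hg01 _) (hY j).aestronglyMeasurable 2
  have hvar : Var[∑ j, Y j; M] ≤ s / 4 := by
    rw [IndepFun.variance_sum fun j _ => hL j]
    · calc ∑ j, Var[Y j; M] ≤ ∑ _j : Fin s, ((1 - 0) / 2 : ℝ) ^ 2 :=
          Finset.sum_le_sum fun j _ => variance_le_sq_of_bounded
            (Filter.Eventually.of_forall fun a => hg01 _) (hY j).aemeasurable
        _ = s / 4 := by simp; ring
    · exact fun j _ j' _ hj => (indepFun_average_pi_pi_gaussianReal b w hj).comp hg hg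
  have hmean : ∀ j, ∫ a, Y j a ∂M = unitMass ((∑ i, b i j) / n) (w / n) := by
    intro j
    rw [unitMass, ← map_average_pi_pi_gaussianReal hn b w j,
      ← integral_indicator_one measurableSet_Icc,
      integral_map (hA j).aemeasurable (by
        exact (measurable_one.indicator measurableSet_Icc).aestronglyMeasurable)]
    rfl
  have hsum : ∫ a, (∑ j, Y j) a ∂M = ∑ j, unitMass ((∑ i, b i j) / n) (w / n) := by
    simp_rw [Finset.sum_apply]
    rw [integral_finsetSum _ fun j _ => (hL j).integrable (by norm_num)]
    exact Finset.sum_congr rfl fun j _ => hmean j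
  have hs' : (0 : ℝ) < s := by exact_mod_cast hs
  have hc : 0 < γ * s := by positivity
  have hset : {a | γ ≤ |fractionInUnit a - (∑ j, unitMass ((∑ i, b i j) / n) (w / n)) / s|} =
      {a | γ * s ≤ |(∑ j, Y j) a - ∫ a, (∑ j, Y j) a ∂M|} := by
    ext a
    rw [Set.mem_ofPred_eq, Set.mem_ofPred_eq, hsum, Finset.sum_apply, fractionInUnit, ← sub_div,
      abs_div, abs_of_pos hs', le_div_iff₀ hs']
  rw [hset]
  refine (meas_ge_le_variance_div_sq (memLp_finsetSum' _ fun j _ => hL j) hc).trans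
    (ENNReal.ofReal_le_ofReal ?_)
  calc Var[∑ j, Y j; M] / (γ * s) ^ 2 ≤ (s / 4) / (γ * s) ^ 2 := by gcongr
    _ = 1 / (4 * s * γ ^ 2) := by field_simp

end LNDP

/-! ### Gaussian mass of the unit interval and calibration of the threshold. -/

namespace LNDP

theorem exp_neg_le_quadratic {u : ℝ} (hu : 0 ≤ u) : Real.exp (-u) ≤ 1 - u + u ^ 2 / 2 := by
  have h := Real.quadratic_le_exp_of_nonneg hu
  rw [Real.exp_neg, inv_le_iff_one_le_mul₀ (Real.exp_pos u)]
  have h0 : 0 ≤ 1 - u + u ^ 2 / 2 := by nlinarith [sq_nonneg (u - 1)]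
  nlinarith [mul_le_mul_of_nonneg_left h h0, pow_nonneg hu 4]

theorem unitMass_eq (p : ℝ) {v : ℝ≥0} (hv : v ≠ 0) :
    unitMass p v =
      (√(2 * Real.pi * v))⁻¹ * ∫ x in (0 : ℝ)..1, Real.exp (-((x - p) ^ 2 / (2 * v))) := by
  rw [unitMass, Measure.real, gaussianReal_apply_eq_integral _ hv, ENNReal.toReal_ofReal
    (integral_nonneg fun x => gaussianPDFReal_nonneg _ _ _), integral_Icc_eq_integral_Ioc,
    ← intervalIntegral.integral_of_le zero_le_one, ← intervalIntegral.integral_const_mul]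
  simp only [gaussianPDFReal, neg_div]

theorem integral_quadratic (p a c : ℝ) :
    ∫ x in (0 : ℝ)..1, (c - (x - p) ^ 2 / a) = c - ((p - 1 / 2) ^ 2 + 1 / 12) / a := by
  rw [intervalIntegral.integral_sub intervalIntegrable_const
      (Continuous.intervalIntegrable (by fun_prop) _ _),
    intervalIntegral.integral_div, intervalIntegral.integral_comp_sub_right fun x => x ^ 2]
  simp only [integral_pow, intervalIntegral.integral_const]
  norm_num
  ring

theorem unitMass_ge (p : ℝ) {v : ℝ≥0} (hv : v ≠ 0) :
    (√(2 * Real.pi * v))⁻¹ * (1 - ((p - 1 / 2) ^ 2 + 1 / 12) / (2 * v)) ≤ unitMass p v := by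
  rw [unitMass_eq p hv, ← integral_quadratic]
  refine mul_le_mul_of_nonneg_left (intervalIntegral.integral_mono_on zero_le_one
    (Continuous.intervalIntegrable (by fun_prop) _ _)
    (Continuous.intervalIntegrable (by fun_prop) _ _) fun x _ => ?_) (by positivity)
  exact Real.one_sub_le_exp_neg _

theorem unitMass_le {p : ℝ} (hp : p ∈ Set.Icc (0 : ℝ) 1) {v : ℝ≥0} (hv : v ≠ 0) :
    unitMass p v ≤ (√(2 * Real.pi * v))⁻¹ *
      (1 + 1 / (8 * v ^ 2) - ((p - 1 / 2) ^ 2 + 1 / 12) / (2 * v)) := by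
  have hv' : (0 : ℝ) < v := by positivity
  rw [unitMass_eq p hv, ← integral_quadratic]
  refine mul_le_mul_of_nonneg_left (intervalIntegral.integral_mono_on zero_le_one
    (Continuous.intervalIntegrable (by fun_prop) _ _)
    (Continuous.intervalIntegrable (by fun_prop) _ _) fun x hx => ?_) (by positivity)
  -- Here `p ∈ [0, 1]` enters: the exponent is at most `1 / (2v)`, so the quadratic error term is at
  -- most `1 / (8v²)`.
  have h1 : (x - p) ^ 2 ≤ 1 := by
    rw [sq_le_one_iff_abs_le_one, abs_le]
    constructor <;> linarith [hx.1, hx.2, hp.1, hp.2]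
  have h2 : (x - p) ^ 2 / (2 * v) ≤ 1 / (2 * v) := by gcongr
  have h3 : 0 ≤ (x - p) ^ 2 / (2 * (v : ℝ)) := by positivity
  have h4 : ((x - p) ^ 2 / (2 * (v : ℝ))) ^ 2 ≤ (1 / (2 * v)) ^ 2 := by gcongr
  have h5 : (1 / (2 * (v : ℝ))) ^ 2 / 2 = 1 / (8 * v ^ 2) := by field_simp; norm_num
  linarith [exp_neg_le_quadratic h3]

/-- The threshold of the server when the averaged noise has variance `v`. -/
noncomputable def threshold (v : ℝ≥0) : ℝ :=
  (√(2 * Real.pi * v))⁻¹ * (1 - (43 / 200 + 1 / 12) / (2 * v))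

/-- The distance from the threshold of the expected fraction for either kind of graph. -/
noncomputable def margin (v : ℝ≥0) : ℝ :=
  (√(2 * Real.pi * v))⁻¹ * (3 / 200 / (2 * v))

theorem margin_pos {v : ℝ≥0} (hv : v ≠ 0) : 0 < margin v := by
  have hv' : (0 : ℝ) < v := by positivity
  unfold margin
  positivity

variable {n s : ℕ}

/-- The squared margin is of order `v⁻³`, which is why `s` must grow like `v³`. -/
theorem deviation_bound_le {v : ℝ≥0} (hv : v ≠ 0) (hs : 10 ^ 6 * (v : ℝ) ^ 3 ≤ s) :
    1 / (4 * s * margin v ^ 2) ≤ 1 / 20 := by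
  have hv' : (0 : ℝ) < v := by positivity
  refine one_div_le_one_div_of_le (by norm_num) ?_
  have h1 : 4 * (s : ℝ) * margin v ^ 2 = s * (9 / 40000) / (2 * Real.pi * v ^ 3) := by
    rw [margin, mul_pow, inv_pow, Real.sq_sqrt (by positivity)]
    field_simp
    ring
  rw [h1, le_div_iff₀ (by positivity)]
  have h2 : Real.pi * (v : ℝ) ^ 3 ≤ 4 * v ^ 3 := by gcongr; exact Real.pi_le_four
  nlinarith [pow_pos hv' 3]

/-- The lower bound on `unitMass` is affine in `(p - 1/2)²`, so only the average of these squares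
matters, and `1/5 = 43/200 - 3/200`. -/
theorem le_mean_unitMass (hs : 0 < s) {v : ℝ≥0} (hv : v ≠ 0) {p : Fin s → ℝ}
    (hp : ∑ j, (p j - 1 / 2) ^ 2 ≤ (s / 5 : ℝ)) :
    threshold v + margin v ≤ (∑ j, unitMass (p j) v) / s := by
  have hs' : (0 : ℝ) < s := by exact_mod_cast hs
  have hv' : (0 : ℝ) < v := by positivity
  rw [le_div_iff₀ hs']
  refine le_trans ?_ (Finset.sum_le_sum fun j _ => unitMass_ge (p j) hv)
  rw [← Finset.mul_sum, threshold, margin, ← mul_add, mul_assoc]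
  refine mul_le_mul_of_nonneg_left ?_ (by positivity)
  rw [Finset.sum_sub_distrib, ← Finset.sum_div, Finset.sum_add_distrib]
  simp only [Finset.sum_const, Finset.card_univ, Fintype.card_fin, nsmul_eq_mul, mul_one]
  have : (∑ j, (p j - 1 / 2) ^ 2 + s * (1 / 12)) / (2 * v) ≤
      (s / 5 + s * (1 / 12)) / (2 * (v : ℝ)) := by gcongr
  refine le_trans (le_of_eq ?_) (sub_le_sub_left this _)
  ring

/-- Since `(p - 1/2)² = 1/4 - p(1 - p) ≥ 24/100` and `25 ≤ v` makes the error term cost at most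
`1/100`, what remains is `23/100 = 43/200 + 3/200`. -/
theorem mean_unitMass_le (hs : 0 < s) {v : ℝ≥0} (hv : 25 ≤ v) {p : Fin s → ℝ}
    (hp : ∀ j, p j ∈ Set.Icc (0 : ℝ) 1) (hp' : ∀ j, p j * (1 - p j) ≤ 1 / 100) :
    (∑ j, unitMass (p j) v) / s ≤ threshold v - margin v := by
  have hs' : (0 : ℝ) < s := by exact_mod_cast hs
  have hv25 : (25 : ℝ) ≤ v := by exact_mod_cast hv
  have hv' : (0 : ℝ) < v := by linarith
  have hv0 : v ≠ 0 := by rintro rfl; simp at hv'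
  rw [div_le_iff₀ hs']
  refine (Finset.sum_le_card_nsmul _ _ (threshold v - margin v) fun j _ => ?_).trans ?_
  · refine (unitMass_le (hp j) hv0).trans ?_
    rw [threshold, margin, ← mul_sub]
    refine mul_le_mul_of_nonneg_left ?_ (by positivity)
    have h1 : (24 / 100 + 1 / 12) / (2 * (v : ℝ)) ≤ ((p j - 1 / 2) ^ 2 + 1 / 12) / (2 * v) := by
      gcongr
      nlinarith [hp' j]
    have h2 : 1 / (8 * (v : ℝ) ^ 2) ≤ 1 / 100 / (2 * v) := by
      rw [div_div, div_le_div_iff₀ (by positivity) (by positivity)]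
      nlinarith
    refine (sub_le_sub_left h1 _).trans ((sub_le_sub_right (add_le_add_right h2 _) _).trans
      (le_of_eq ?_))
    ring
  · simp [mul_comm]

theorem le_prob_of_compl_subset {α : Type*} [MeasurableSpace α] {M : Measure α}
    [IsProbabilityMeasure M] {E B : Set α} (h : Eᶜ ⊆ B) (hB : M B ≤ ENNReal.ofReal (1 / 20)) :
    ENNReal.ofReal (19 / 20) ≤ M E := by
  refine ENNReal.le_of_add_le_add_right (a := ENNReal.ofReal (1 / 20))
    ENNReal.ofReal_ne_top ?_
  rw [← ENNReal.ofReal_add (by norm_num) (by norm_num)]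
  calc ENNReal.ofReal (19 / 20 + 1 / 20) = M Set.univ := by norm_num
    _ ≤ M (E ∪ B) := measure_mono fun x _ => or_iff_not_imp_left.2 fun hx => h hx
    _ ≤ M E + M B := measure_union_le _ _
    _ ≤ _ := by gcongr

theorem le_prob_regular (hn : 0 < n) (hs : 0 < s) (b : Fin n → Fin s → ℝ) {w : ℝ≥0}
    (hw : w / n ≠ 0) (hsv : 10 ^ 6 * ((w / n : ℝ≥0) : ℝ) ^ 3 ≤ s)
    (hb : ∑ j, ((∑ i, b i j) / n - 1 / 2) ^ 2 ≤ (s / 5 : ℝ)) :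
    ENNReal.ofReal (19 / 20) ≤ (Measure.pi fun i => Measure.pi fun j => gaussianReal (b i j) w)
      {a | decideVerdict (threshold (w / n)) a = Verdict.regular} := by
  refine le_prob_of_compl_subset (fun a ha => ?_) ((fractionInUnit_deviation hn hs b w
    (margin_pos hw)).trans (ENNReal.ofReal_le_ofReal (deviation_bound_le hw hsv)))
  have hmean := le_mean_unitMass hs hw hb
  have ha' : fractionInUnit a < threshold (w / n) := by
    by_contra! h
    exact ha (if_pos h)
  rw [Set.mem_ofPred_eq, abs_sub_comm]
  exact le_trans (by linarith) (le_abs_self _)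

theorem le_prob_starpartite (hn : 0 < n) (hs : 0 < s) (b : Fin n → Fin s → ℝ) {w : ℝ≥0}
    (hw : 25 ≤ w / n) (hsv : 10 ^ 6 * ((w / n : ℝ≥0) : ℝ) ^ 3 ≤ s)
    (hb : ∀ j, (∑ i, b i j) / n ∈ Set.Icc (0 : ℝ) 1)
    (hb' : ∀ j, (∑ i, b i j) / n * (1 - (∑ i, b i j) / n) ≤ 1 / 100) :
    ENNReal.ofReal (19 / 20) ≤ (Measure.pi fun i => Measure.pi fun j => gaussianReal (b i j) w)
      {a | decideVerdict (threshold (w / n)) a = Verdict.starpartite} := by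
  have hw0 : w / n ≠ 0 := (lt_of_lt_of_le (by norm_num) hw).ne'
  refine le_prob_of_compl_subset (fun a ha => ?_) ((fractionInUnit_deviation hn hs b w
    (margin_pos hw0)).trans (ENNReal.ofReal_le_ofReal (deviation_bound_le hw0 hsv)))
  have hmean := mean_unitMass_le hs hw hb hb'
  have ha' : threshold (w / n) ≤ fractionInUnit a := by
    by_contra! h
    exact ha (if_neg h.not_ge)
  rw [Set.mem_ofPred_eq]
  exact le_trans (by linarith) (le_abs_self _)

end LNDP

/-! ### Moments of the hit fraction in a regular set system. -/

namespace LNDP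

theorem exp_neg_two_mul_le {x : ℝ} (hx : 99 / 100 ≤ x) :
    Real.exp (-(2 * x)) * (1 + 2 * (1 / 100)) ≤ 15 / 100 := by
  have h1 : 2.7 ≤ Real.exp 1 := by linarith [Real.exp_one_gt_d9]
  have h2 : (98 / 100 : ℝ) ≤ Real.exp (-(2 / 100)) := by
    linarith [Real.one_sub_le_exp_neg (2 / 100)]
  have h3 : Real.exp 1 ^ 2 * Real.exp (-(2 / 100)) ≤ Real.exp (2 * x) := by
    rw [← Real.exp_nat_mul, ← Real.exp_add]
    exact Real.exp_le_exp.2 (by norm_num; linarith)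
  have h4 : (7 : ℝ) ≤ Real.exp (2 * x) := by
    refine le_trans ?_ h3
    calc (7 : ℝ) ≤ 2.7 ^ 2 * (98 / 100) := by norm_num
      _ ≤ _ := by gcongr
  rw [Real.exp_neg, inv_mul_le_iff₀ (Real.exp_pos _)]
  linarith

theorem le_one_sub_pow {θ : ℝ} (h1 : θ ≤ 1 / 100) {m : ℕ} (hm : m * θ ≤ 1) :
    35 / 100 ≤ (1 - θ) ^ m := by
  have hθ : 0 < 1 - θ := by linarith
  have h2 : Real.exp (-(θ / (1 - θ))) ≤ 1 - θ := by
    rw [Real.exp_neg]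
    refine inv_le_of_inv_le₀ hθ ?_
    refine le_trans (le_of_eq ?_) (Real.add_one_le_exp _)
    field_simp
    ring
  have h3 : (m : ℝ) * (θ / (1 - θ)) ≤ 1 + 1 / 99 := by
    rw [← mul_div_assoc, div_le_iff₀ hθ]
    linarith
  calc (35 / 100 : ℝ) ≤ Real.exp (-1) * Real.exp (-(1 / 99)) := by
        have e1 : (0.36 : ℝ) ≤ Real.exp (-1) := by linarith [Real.exp_neg_one_gt_d9]
        have e2 : (98 / 99 : ℝ) ≤ Real.exp (-(1 / 99)) := by
          linarith [Real.one_sub_le_exp_neg (1 / 99)]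
        calc (35 / 100 : ℝ) ≤ 0.36 * (98 / 99) := by norm_num
          _ ≤ _ := by gcongr
    _ ≤ Real.exp (m * (-(θ / (1 - θ)))) := by
        rw [← Real.exp_add]
        exact Real.exp_le_exp.2 (by linarith)
    _ = Real.exp (-(θ / (1 - θ))) ^ m := Real.exp_nat_mul _ _
    _ ≤ _ := by gcongr

theorem exp_le_one_add_two_mul {x : ℝ} (h0 : 0 ≤ x) (h1 : x ≤ 1) : Real.exp x ≤ 1 + 2 * x := by
  have h := Real.abs_exp_sub_one_sub_id_le (abs_le.2 ⟨by linarith, h1⟩)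
  nlinarith [(abs_le.1 h).2]

open Classical in
theorem hitBit_eq_one_sub {n m : ℕ} (A : Finset (Fin n)) (x : Fin m → Fin n) :
    hitBit (A : Set (Fin n)) x = 1 - if x ∈ Fintype.piFinset (fun _ => Aᶜ) then 1 else 0 := by
  by_cases h : ∃ k, x k ∈ A
  · obtain ⟨k, hk⟩ := h
    have h' : x ∉ Fintype.piFinset (fun _ => Aᶜ) := fun hx =>
      Finset.mem_compl.1 (Fintype.mem_piFinset.1 hx k) hk
    rw [if_neg h', hitBit, if_pos ⟨k, hk⟩, sub_zero]
  · have h' : x ∈ Fintype.piFinset (fun _ => Aᶜ) :=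
      Fintype.mem_piFinset.2 fun k => Finset.mem_compl.2 fun hk => h ⟨k, hk⟩
    rw [if_pos h', hitBit, if_neg (by simpa using h), sub_self]

/-- The second moment about `1 / 2` of the fraction of sets of a `t`-regular set system that are
hit by `⌊n / t⌋` random nodes is at most `1 / 20`. -/
theorem sum_sq_hit_fraction_le {n t : ℕ} (ht : 0 < t) (htn : 100 * t ≤ n)
    (N : Fin n → Finset (Fin n)) (hN : ∀ i, (N i).card = t)
    (hN' : ∀ w, ∑ i, (if w ∈ N i then (1 : ℝ) else 0) = t) :
    ∑ x : Fin (n / t) → Fin n, ((∑ i, hitBit (N i : Set (Fin n)) x) / n - 1 / 2) ^ 2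
      ≤ (n : ℝ) ^ (n / t) / 20 := by
  classical
  have hn : 0 < n := by omega
  have hn' : (0 : ℝ) < n := by exact_mod_cast hn
  have ht' : (0 : ℝ) < t := by exact_mod_cast ht
  set m := n / t with hm
  have hmt : (m : ℝ) * t ≤ n := by exact_mod_cast Nat.div_mul_le_self n t
  have hmt' : (n : ℝ) - t ≤ m * t := by
    have := Nat.lt_div_mul_add (a := n) ht
    have : (n : ℝ) < m * t + t := by exact_mod_cast this
    linarith
  have htn' : 100 * (t : ℝ) ≤ n := by exact_mod_cast htn
  let F : Finset (Fin n) → Finset (Fin m → Fin n) := fun A => Fintype.piFinset fun _ => Aᶜ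
  -- The indicator that `N i` is missed. Sums over all words `x` are expectations scaled by `n ^ m`.
  let u : Fin n → (Fin m → Fin n) → ℝ := fun i x => if x ∈ F (N i) then 1 else 0
  have hcard : ∀ A : Finset (Fin n), ∑ x, (if x ∈ F A then (1 : ℝ) else 0) =
      ((n : ℝ) - A.card) ^ m := by
    intro A
    have hA : A.card ≤ n := by simpa using A.card_le_univ
    simp only [Finset.sum_ite_mem, Finset.univ_inter, Finset.sum_const, nsmul_eq_mul, mul_one]
    rw [Fintype.card_piFinset_const, Finset.card_compl, Fintype.card_fin]
    push_cast [hA]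
    simp
  have hu1 : ∀ i, ∑ x, u i x = ((n : ℝ) - t) ^ m := fun i => by
    rw [← hN i]
    exact hcard (N i)
  have hu2 : ∀ i i', ∑ x, u i x * u i' x = ((n : ℝ) - (N i ∪ N i').card) ^ m := by
    intro i i'
    rw [← hcard]
    refine Finset.sum_congr rfl fun x _ => ?_
    have : x ∈ F (N i ∪ N i') ↔ x ∈ F (N i) ∧ x ∈ F (N i') := by
      simp only [F, Fintype.mem_piFinset, Finset.mem_compl, Finset.mem_union, not_or,
        forall_and]
    simp only [u, this, ite_and]
    split_ifs <;> simp
  have hoverlap : ∀ i, ∑ i', ((N i ∩ N i').card : ℝ) = t * t := by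
    intro i
    have h1 : ∀ i', ((N i ∩ N i').card : ℝ) = ∑ w ∈ N i, if w ∈ N i' then (1 : ℝ) else 0 := by
      intro i'
      rw [Finset.sum_boole, Finset.filter_mem_eq_inter]
    simp_rw [h1]
    rw [Finset.sum_comm]
    simp [hN', hN]
  set c := (m : ℝ) * t / n with hc
  have hc1 : c ≤ 1 := by rw [hc, div_le_one hn']; exact hmt
  have hc99 : 99 / 100 ≤ c := by
    rw [hc, le_div_iff₀ hn']
    linarith
  have hpair : ∀ i i', ((n : ℝ) - (N i ∪ N i').card) ^ m ≤
      n ^ m * (Real.exp (-(2 * c)) * (1 + 2 * ((m : ℝ) / n * (N i ∩ N i').card))) := by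
    intro i i'
    have hun : ((N i ∪ N i').card : ℝ) + (N i ∩ N i').card = 2 * t := by
      have := Finset.card_union_add_card_inter (N i) (N i')
      rw [hN, hN] at this
      have : ((N i ∪ N i').card : ℝ) + (N i ∩ N i').card = t + t := by exact_mod_cast this
      linarith
    have hU : ((N i ∪ N i').card : ℝ) ≤ n := by
      have : (N i ∪ N i').card ≤ n := by simpa using (N i ∪ N i').card_le_univ
      exact_mod_cast this
    have hO : ((N i ∩ N i').card : ℝ) ≤ t := by
      have : (N i ∩ N i').card ≤ t := (Finset.card_le_card Finset.inter_subset_left).trans_eq (hN i)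
      exact_mod_cast this
    set U := ((N i ∪ N i').card : ℝ)
    set O := ((N i ∩ N i').card : ℝ)
    have hO1 : (m : ℝ) / n * O ≤ 1 := by
      refine le_trans ?_ hc1
      rw [hc, div_mul_eq_mul_div]
      gcongr
    calc ((n : ℝ) - U) ^ m = n ^ m * (1 - U / n) ^ m := by
          rw [← mul_pow]
          congr 1
          field_simp
      _ ≤ n ^ m * (Real.exp (-(U / n))) ^ m := by
          have : 0 ≤ 1 - U / n := by
            rw [sub_nonneg, div_le_one hn']
            exact hU
          gcongr
          exact Real.one_sub_le_exp_neg _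
      _ = n ^ m * (Real.exp (-(2 * c)) * Real.exp (m / n * O)) := by
          rw [← Real.exp_nat_mul, ← Real.exp_add]
          congr 2
          rw [hc, show U = 2 * t - O by linarith]
          field_simp
          ring
      _ ≤ _ := by
          gcongr
          exact exp_le_one_add_two_mul (by positivity) hO1
  have hsq : ∑ x, (∑ i, u i x) ^ 2 ≤ n ^ m * (n : ℝ) ^ 2 * (15 / 100) := by
    calc ∑ x, (∑ i, u i x) ^ 2 = ∑ i, ∑ i', ∑ x, u i x * u i' x := by
          simp_rw [sq, Finset.sum_mul_sum]
          rw [Finset.sum_comm]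
          exact Finset.sum_congr rfl fun i _ => Finset.sum_comm
      _ ≤ ∑ i, ∑ i', (n : ℝ) ^ m * (Real.exp (-(2 * c)) *
            (1 + 2 * ((m : ℝ) / n * (N i ∩ N i').card))) := by
          refine Finset.sum_le_sum fun i _ => Finset.sum_le_sum fun i' _ => ?_
          rw [hu2]
          exact hpair i i'
      _ = n ^ m * (n : ℝ) ^ 2 * (Real.exp (-(2 * c)) * (1 + 2 * (c * t / n))) := by
          simp_rw [← Finset.mul_sum, Finset.sum_add_distrib, ← Finset.mul_sum, hoverlap]
          simp only [Finset.sum_const, Finset.card_univ, Fintype.card_fin, nsmul_eq_mul, mul_one]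
          rw [hc]
          field_simp
      _ ≤ _ := by
          gcongr
          refine le_trans ?_ (exp_neg_two_mul_le hc99)
          have : c * t / n ≤ 1 / 100 := by
            rw [div_le_iff₀ hn']
            nlinarith
          gcongr
  have hlin : n ^ m * (n : ℝ) * (35 / 100) ≤ ∑ x, ∑ i, u i x := by
    rw [Finset.sum_comm]
    simp_rw [hu1]
    simp only [Finset.sum_const, Finset.card_univ, Fintype.card_fin, nsmul_eq_mul]
    have h1 : ((n : ℝ) - t) ^ m = n ^ m * (1 - t / n) ^ m := by
      rw [← mul_pow]
      congr 1
      field_simp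
    have h2 := le_one_sub_pow (θ := (t : ℝ) / n)
      (by rw [div_le_iff₀ hn']; linarith) (m := m) (by rw [← mul_div_assoc]; exact hc1)
    rw [h1]
    calc _ ≤ (n : ℝ) ^ m * n * (1 - t / n) ^ m := by gcongr
      _ = _ := by ring
  -- With `q` the missed fraction this is `q² - q + 1/4`; the two moment bounds give `0.15 - 0.35 +
  -- 0.25 = 1/20`.
  have hpt : ∀ x, ((∑ i, hitBit (N i : Set (Fin n)) x) / n - 1 / 2) ^ 2 =
      (∑ i, u i x) ^ 2 / n ^ 2 - (∑ i, u i x) / n + 1 / 4 := by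
    intro x
    simp_rw [hitBit_eq_one_sub, Finset.sum_sub_distrib]
    change ((_ - ∑ i, u i x) / _ - _) ^ 2 = _
    simp only [Finset.sum_const, Finset.card_univ, Fintype.card_fin, nsmul_eq_mul, mul_one]
    field_simp
    ring
  simp_rw [hpt]
  rw [Finset.sum_add_distrib, Finset.sum_sub_distrib, ← Finset.sum_div, ← Finset.sum_div]
  simp only [Finset.sum_const, Finset.card_univ, Fintype.card_fun, Fintype.card_fin, nsmul_eq_mul]
  have h1 : (∑ x, (∑ i, u i x) ^ 2) / (n : ℝ) ^ 2 ≤ n ^ m * (15 / 100) := by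
    rw [div_le_iff₀ (by positivity)]
    linarith
  have h2 : n ^ m * (35 / 100) ≤ (∑ x, ∑ i, u i x) / (n : ℝ) := by
    rw [le_div_iff₀ hn']
    linarith
  push_cast
  linarith

end LNDP

/-! ### Hit fractions in regular and starpartite graphs. -/

namespace LNDP

theorem uniformAverage_ge {n : ℕ} {S : Set (SimpleGraph (Fin n))} (hS : S.Nonempty)
    {f : SimpleGraph (Fin n) → ℝ≥0∞} {c : ℝ≥0∞} (h : ∀ G ∈ S, c ≤ f G) :
    c ≤ uniformAverage S f := by
  have hcard : S.ncard ≠ 0 := ((Set.ncard_pos S.toFinite).2 hS).ne'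
  rw [uniformAverage, ENNReal.le_div_iff_mul_le (Or.inl (by exact_mod_cast hcard))
    (Or.inl (ENNReal.natCast_ne_top _)), mul_comm, ← nsmul_eq_mul,
    Set.ncard_eq_toFinset_card S S.toFinite]
  exact Finset.card_nsmul_le_sum _ _ _ fun G hG => h G (S.toFinite.mem_toFinset.1 hG)

theorem starpartiteGraphs_nonempty {n t : ℕ} (h : t ≤ n) : (starpartiteGraphs n t).Nonempty := by
  obtain ⟨T, -, hT⟩ := Finset.exists_subset_card_eq (s := (Finset.univ : Finset (Fin n))) (n := t)
    (by simpa using h)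
  exact ⟨_, T, hT, rfl⟩

/-- The circulant graph with steps `±1, …, ±r`. An even degree avoids any parity condition on `n`.
-/
theorem regularGraphs_nonempty {n r : ℕ} (h : 2 * r < n) : (regularGraphs n (2 * r)).Nonempty := by
  classical
  have hn : NeZero n := ⟨by omega⟩
  let s : Finset (Fin n) := Finset.univ.filter fun d => 1 ≤ d.val ∧ d.val ≤ r
  have hs : s.card = r := by
    have : s.map Fin.valEmbedding = Finset.Icc 1 r := by
      ext k
      simp only [s, Finset.mem_map, Finset.mem_filter, Finset.mem_univ, true_and,
        Fin.valEmbedding_apply, Finset.mem_Icc]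
      constructor
      · rintro ⟨d, hd, rfl⟩
        exact hd
      · exact fun hk => ⟨⟨k, by omega⟩, hk, rfl⟩
    rw [← Finset.card_map Fin.valEmbedding, this, Nat.card_Icc]
    omega
  have hneg : ∀ d ∈ s, -d ∉ s := by
    intro d hd hd'
    simp only [s, Finset.mem_filter, Finset.mem_univ, true_and, Fin.val_neg'] at hd hd'
    rw [Nat.mod_eq_of_lt (by omega)] at hd'
    omega
  have hzero : (0 : Fin n) ∉ s := by simp [s]
  refine ⟨SimpleGraph.circulantGraph (s : Set (Fin n)), fun v => ?_⟩
  have hN : (SimpleGraph.circulantGraph (s : Set (Fin n))).neighborFinset v =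
      (s.image fun d => v - d) ∪ s.image fun d => v + d := by
    ext w
    simp only [SimpleGraph.mem_neighborFinset, SimpleGraph.circulantGraph_adj, Finset.mem_coe,
      Finset.mem_union, Finset.mem_image]
    constructor
    · rintro ⟨-, h | h⟩
      · exact Or.inl ⟨_, h, by abel⟩
      · exact Or.inr ⟨_, h, by abel⟩
    · rintro (⟨d, hd, rfl⟩ | ⟨d, hd, rfl⟩)
      · refine ⟨fun h => hzero ?_, Or.inl (by simpa using hd)⟩
        rwa [sub_eq_self.1 h.symm] at hd
      · refine ⟨fun h => hzero ?_, Or.inr (by simpa using hd)⟩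
        rwa [show d = 0 by simpa using h] at hd
  have hdisj : Disjoint (s.image fun d => v - d) (s.image fun d => v + d) := by
    rw [Finset.disjoint_left]
    intro w hw hw'
    obtain ⟨d, hd, rfl⟩ := Finset.mem_image.1 hw
    obtain ⟨d', hd', he⟩ := Finset.mem_image.1 hw'
    refine hneg d hd ?_
    rw [sub_eq_add_neg] at he
    rwa [← add_left_cancel he]
  have hcard : ((SimpleGraph.circulantGraph (s : Set (Fin n))).neighborFinset v).card = 2 * r := by
    rw [hN, Finset.card_union_of_disjoint hdisj,
      Finset.card_image_of_injective _ sub_right_injective,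
      Finset.card_image_of_injective _ (add_right_injective v), hs]
    omega
  rw [← SimpleGraph.card_neighborFinset_eq_degree]
  convert hcard

theorem hitBit_starGraph {n m : ℕ} {T : Finset (Fin n)} {i : Fin n} (hi : i ∉ T)
    (x : Fin m → Fin n) :
    hitBit ((starGraph T).neighborSet i) x = hitBit (T : Set (Fin n)) x := by
  refine hitBit_congr fun k => ?_
  simp only [SimpleGraph.mem_neighborSet, starGraph, SimpleGraph.fromRel_adj, hi, false_or,
    Finset.mem_coe]
  exact ⟨fun h => h.2, fun h => ⟨fun he => hi (he ▸ h), h⟩⟩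

theorem average_hitBit_mem_Icc {n m : ℕ} (hn : 0 < n) (N : Fin n → Set (Fin n))
    (x : Fin m → Fin n) : (∑ i, hitBit (N i) x) / n ∈ Set.Icc (0 : ℝ) 1 := by
  have hn' : (0 : ℝ) < n := by exact_mod_cast hn
  have h01 : ∀ i, 0 ≤ hitBit (N i) x ∧ hitBit (N i) x ≤ 1 := fun i => by
    rcases hitBit_eq_zero_or_one (N i) x with h | h <;> norm_num [h]
  refine ⟨div_nonneg (Finset.sum_nonneg fun i _ => (h01 i).1) hn'.le, ?_⟩
  rw [div_le_one hn']
  exact (Finset.sum_le_sum fun i _ => (h01 i).2).trans (by simp)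

/-- Only the `t ≤ n / 100` nodes of `T` can deviate from the common bit, so the average is within
`1/100` of `0` or `1`, for every choice of `x`. -/
theorem average_hitBit_starGraph {n m t : ℕ} (hn : 0 < n) (htn : 100 * t ≤ n) {T : Finset (Fin n)}
    (hT : T.card = t) (x : Fin m → Fin n) :
    (∑ i, hitBit ((starGraph T).neighborSet i) x) / n *
      (1 - (∑ i, hitBit ((starGraph T).neighborSet i) x) / n) ≤ (1 / 100 : ℝ) := by
  classical
  have hn' : (0 : ℝ) < n := by exact_mod_cast hn
  have htn' : 100 * (t : ℝ) ≤ n := by exact_mod_cast htn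
  obtain ⟨hp0, hp1⟩ := average_hitBit_mem_Icc hn (starGraph T).neighborSet x
  set p := (∑ i, hitBit ((starGraph T).neighborSet i) x) / (n : ℝ) with hp
  have hdev : |(∑ i, hitBit ((starGraph T).neighborSet i) x) - n * hitBit (T : Set (Fin n)) x|
      ≤ t := by
    have h1 : (∑ i, hitBit ((starGraph T).neighborSet i) x) - n * hitBit (T : Set (Fin n)) x =
        ∑ i, (hitBit ((starGraph T).neighborSet i) x - hitBit (T : Set (Fin n)) x) := by
      simp [Finset.sum_sub_distrib]
    rw [h1]
    refine (Finset.abs_sum_le_sum_abs _ _).trans ?_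
    calc _ ≤ ∑ i, (if i ∈ T then (1 : ℝ) else 0) := by
          refine Finset.sum_le_sum fun i _ => ?_
          split_ifs with hi
          · rw [← sq_le_one_iff_abs_le_one]
            exact hitBit_sub_sq_le_one _ _ _
          · rw [hitBit_starGraph hi, sub_self, abs_zero]
      _ = t := by simp [hT]
  have hsum : ∑ i, hitBit ((starGraph T).neighborSet i) x = n * p := by
    rw [hp]
    field_simp
  rw [hsum, abs_le] at hdev
  rcases hitBit_eq_zero_or_one (T : Set (Fin n)) x with h | h <;> rw [h] at hdev
  · have : p ≤ 1 / 100 := by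
      refine le_of_mul_le_mul_left ?_ hn'
      linarith [hdev.2]
    nlinarith
  · have : 1 - p ≤ 1 / 100 := by
      refine le_of_mul_le_mul_left ?_ hn'
      linarith [hdev.1]
    nlinarith

theorem sum_sq_hit_fraction_regular_le {n t : ℕ} (ht : 0 < t) (htn : 100 * t ≤ n)
    {G : SimpleGraph (Fin n)} (hG : G ∈ regularGraphs n t) :
    ∑ x : Fin (n / t) → Fin n, ((∑ i, hitBit (G.neighborSet i) x) / n - 1 / 2) ^ 2
      ≤ (n : ℝ) ^ (n / t) / 20 := by
  classical
  have hdeg : ∀ i, (G.neighborFinset i).card = t := fun i => by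
    rw [SimpleGraph.card_neighborFinset_eq_degree]
    convert hG i
  have h := sum_sq_hit_fraction_le ht htn (fun i => G.neighborFinset i) hdeg fun w => ?_
  · simpa only [SimpleGraph.coe_neighborFinset] using h
  · simp_rw [SimpleGraph.mem_neighborFinset, G.adj_comm _ w, ← SimpleGraph.mem_neighborFinset]
    rw [← hdeg w, Finset.sum_boole, Finset.filter_mem_eq_inter, Finset.univ_inter]

/-- In a regular graph the fractions of nodes hit by the public multisets are typically bounded
away from `0` and `1`, whatever the joint law of the multisets. -/
theorem prob_sum_sq_hit_fraction_ge {n t s : ℕ} (ht : 0 < t) (hs : 0 < s) (htn : 100 * t ≤ n)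
    {G : SimpleGraph (Fin n)} (hG : G ∈ regularGraphs n t) {Pub : Type} [MeasurableSpace Pub]
    (D : Measure Pub) [IsProbabilityMeasure D] {S : Pub → Fin s → Fin (n / t) → Fin n}
    (hS : Measurable S)
    (hD : ∀ (j : Fin s) (x : Fin (n / t) → Fin n), D {ρ | S ρ j = x} = ((n : ℝ≥0∞) ^ (n / t))⁻¹) :
    D {ρ | (s / 5 : ℝ) ≤ ∑ j, ((∑ i, hitBit (G.neighborSet i) (S ρ j)) / n - 1 / 2) ^ 2} ≤
      ENNReal.ofReal (1 / 4) := by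
  have hn : (n : ℝ) ≠ 0 := by
    have : n ≠ 0 := by omega
    exact_mod_cast this
  have hs' : (0 : ℝ) < s := by exact_mod_cast hs
  let f : (Fin (n / t) → Fin n) → ℝ := fun x =>
    ((∑ i, hitBit (G.neighborSet i) x) / n - 1 / 2) ^ 2
  have hf : ∀ x, 0 ≤ f x := fun x => sq_nonneg _
  have hSj : ∀ j, Measurable fun ρ => S ρ j := fun j => (measurable_pi_apply j).comp hS
  have hfS : ∀ j, Measurable fun ρ => f (S ρ j) := fun j => (measurable_of_countable f).comp (hSj j)
  have hint : ∀ j, Integrable (fun ρ => f (S ρ j)) D := fun j => by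
    obtain ⟨C, hC⟩ := (Set.finite_range f).bddAbove
    refine Integrable.of_bound (hfS j).aestronglyMeasurable C (Filter.Eventually.of_forall fun ρ => ?_)
    rw [Real.norm_of_nonneg (hf _)]
    exact hC ⟨_, rfl⟩
  have hmean : ∀ j, ∫ ρ, f (S ρ j) ∂D ≤ 1 / 20 := by
    intro j
    have hsm : AEStronglyMeasurable f (D.map fun ρ => S ρ j) :=
      (measurable_of_countable f).aestronglyMeasurable
    have : IsProbabilityMeasure (D.map fun ρ => S ρ j) :=
      Measure.isProbabilityMeasure_map (hSj j).aemeasurable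
    rw [← integral_map (hSj j).aemeasurable hsm, integral_fintype Integrable.of_finite]
    have hreal : ∀ x, (D.map fun ρ => S ρ j).real {x} = ((n : ℝ) ^ (n / t))⁻¹ := by
      intro x
      rw [Measure.real, Measure.map_apply (hSj j) (measurableSet_singleton x)]
      have h : D ((fun ρ => S ρ j) ⁻¹' {x}) = ((n : ℝ≥0∞) ^ (n / t))⁻¹ := hD j x
      rw [h]
      simp
    simp_rw [hreal, smul_eq_mul]
    rw [← Finset.mul_sum, inv_mul_le_iff₀ (by positivity)]
    have := sum_sq_hit_fraction_regular_le ht htn hG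
    change ∑ x, f x ≤ _ at this
    linarith
  have hF : Integrable (fun ρ => ∑ j, f (S ρ j)) D := integrable_finsetSum _ fun j _ => hint j
  have hM := mul_meas_ge_le_integral_of_nonneg (μ := D) (f := fun ρ => ∑ j, f (S ρ j))
    (Filter.Eventually.of_forall fun ρ => Finset.sum_nonneg fun j _ => hf _) hF (s / 5 : ℝ)
  rw [integral_finsetSum _ fun j _ => hint j] at hM
  have h2 : ∑ j, ∫ ρ, f (S ρ j) ∂D ≤ s * (1 / 20) := by
    simpa using Finset.sum_le_sum fun j (_ : j ∈ Finset.univ) => hmean j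
  -- Markov: the expected sum is at most `s / 20`. Linearity of expectation makes the joint law of
  -- the multisets irrelevant.
  have h3 : D.real {ρ | (s / 5 : ℝ) ≤ ∑ j, f (S ρ j)} ≤ 1 / 4 := by
    refine le_of_mul_le_mul_left ?_ (show (0 : ℝ) < s / 5 by positivity)
    linarith
  rw [Measure.real] at h3
  exact (ENNReal.le_ofReal_iff_toReal_le (measure_ne_top _ _) (by norm_num)).2 h3

end LNDP

/-! ### Success probabilities of the noisy-bit algorithm. -/

namespace LNDP

variable {n m s : ℕ} {Pub : Type} [MeasurableSpace Pub] (D : Measure Pub) [IsProbabilityMeasure D]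
  {S : Pub → Fin s → Fin m → Fin n} (hS : Measurable S) (σ : ℝ≥0) (τ : ℝ)

theorem outputProb_noisyBitAlgorithm (G : SimpleGraph (Fin n)) (x : Verdict) :
    (noisyBitAlgorithm D S hS σ τ).outputProb G {x} =
      ∫⁻ ρ, (Measure.pi fun i => Measure.pi fun j =>
        gaussianReal (hitBit (G.neighborSet i) (S ρ j)) (σ ^ 2)) {a | decideVerdict τ a = x} ∂D := by
  refine lintegral_congr fun ρ => ?_
  have hE : MeasurableSet {a : Fin n → Fin s → ℝ | decideVerdict τ a = x} :=
    measurable_decideVerdict τ (MeasurableSet.of_discrete (s := {x}))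
  have h1 : ∀ a : Fin n → Fin s → ℝ,
      (Kernel.deterministic (decideVerdict τ) (measurable_decideVerdict τ)) a {x} =
        {a | decideVerdict τ a = x}.indicator 1 a := by
    intro a
    rw [Kernel.deterministic_apply' _ _ MeasurableSet.of_discrete]
    rfl
  exact (lintegral_congr h1).trans (lintegral_indicator_one hE)

theorem le_outputProb_starpartite {t : ℕ} (hn : 0 < n) (hs : 0 < s) (htn : 100 * t ≤ n)
    (hv : 25 ≤ σ ^ 2 / n) (hsv : 10 ^ 6 * ((σ ^ 2 / n : ℝ≥0) : ℝ) ^ 3 ≤ s)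
    {G : SimpleGraph (Fin n)} (hG : G ∈ starpartiteGraphs n t) :
    2 / 3 ≤ (noisyBitAlgorithm D S hS σ (threshold (σ ^ 2 / n))).outputProb G
      {Verdict.starpartite} := by
  obtain ⟨T, hT, rfl⟩ := hG
  rw [outputProb_noisyBitAlgorithm]
  calc (2 / 3 : ℝ≥0∞) ≤ ENNReal.ofReal (19 / 20) := by
        rw [show (2 / 3 : ℝ≥0∞) = ENNReal.ofReal (2 / 3) by
          rw [ENNReal.ofReal_div_of_pos (by norm_num)]; norm_num]
        exact ENNReal.ofReal_le_ofReal (by norm_num)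
    _ = ∫⁻ _, ENNReal.ofReal (19 / 20) ∂D := by simp
    _ ≤ _ := lintegral_mono fun ρ => le_prob_starpartite hn hs
        (fun i j => hitBit ((starGraph T).neighborSet i) (S ρ j)) hv hsv
        (fun j => average_hitBit_mem_Icc hn _ _) fun j => average_hitBit_starGraph hn htn hT _

theorem le_outputProb_regular {t : ℕ} {S : Pub → Fin s → Fin (n / t) → Fin n} (hS : Measurable S)
    (hD : ∀ (j : Fin s) (x : Fin (n / t) → Fin n), D {ρ | S ρ j = x} = ((n : ℝ≥0∞) ^ (n / t))⁻¹)
    (ht : 0 < t) (hs : 0 < s) (htn : 100 * t ≤ n)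
    (hv : σ ^ 2 / n ≠ 0) (hsv : 10 ^ 6 * ((σ ^ 2 / n : ℝ≥0) : ℝ) ^ 3 ≤ s)
    {G : SimpleGraph (Fin n)} (hG : G ∈ regularGraphs n t) :
    2 / 3 ≤ (noisyBitAlgorithm D S hS σ (threshold (σ ^ 2 / n))).outputProb G
      {Verdict.regular} := by
  have hn : 0 < n := by omega
  rw [outputProb_noisyBitAlgorithm]
  have hbad := prob_sum_sq_hit_fraction_ge ht hs htn hG D hS hD
  set B := {ρ | (s / 5 : ℝ) ≤ ∑ j, ((∑ i, hitBit (G.neighborSet i) (S ρ j)) / n - 1 / 2) ^ 2}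
  have hB : MeasurableSet B := by
    have : B = S ⁻¹' {S | (s / 5 : ℝ) ≤
      ∑ j, ((∑ i, hitBit (G.neighborSet i) (S j)) / n - 1 / 2) ^ 2} := rfl
    rw [this]
    exact hS (Set.to_countable _).measurableSet
  have hgood : ENNReal.ofReal (3 / 4) ≤ D Bᶜ := by
    rw [prob_compl_eq_one_sub hB, ← ENNReal.ofReal_one]
    refine ENNReal.le_sub_of_add_le_right (measure_ne_top _ _) ?_
    calc ENNReal.ofReal (3 / 4) + D B ≤ ENNReal.ofReal (3 / 4) + ENNReal.ofReal (1 / 4) := by gcongr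
      _ = ENNReal.ofReal 1 := by
        rw [← ENNReal.ofReal_add (by norm_num) (by norm_num)]
        norm_num
  -- Good public strings have probability at least `3/4`, and on each the noise spoils the verdict
  -- with probability at most `1/20`; `57/80` exceeds `2/3`.
  calc (2 / 3 : ℝ≥0∞) ≤ ENNReal.ofReal (19 / 20) * ENNReal.ofReal (3 / 4) := by
        rw [show (2 / 3 : ℝ≥0∞) = ENNReal.ofReal (2 / 3) by
          rw [ENNReal.ofReal_div_of_pos (by norm_num)]; norm_num,
          ← ENNReal.ofReal_mul (by norm_num)]
        exact ENNReal.ofReal_le_ofReal (by norm_num)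
    _ ≤ ENNReal.ofReal (19 / 20) * D Bᶜ := by gcongr
    _ = ∫⁻ _ in Bᶜ, ENNReal.ofReal (19 / 20) ∂D := by simp
    _ ≤ ∫⁻ ρ in Bᶜ, _ ∂D := setLIntegral_mono' hB.compl fun ρ hρ => le_prob_regular hn hs
        (fun i j => hitBit (G.neighborSet i) (S ρ j)) hv hsv
        (not_le.1 (show ¬ (s / 5 : ℝ) ≤ _ from hρ)).le
    _ ≤ _ := setLIntegral_le_lintegral _ _

end LNDP

/-! ### Choice of parameters. -/

theorem mainTheorem11 :
    ∃ C c : ℝ, 0 < C ∧ 0 < c ∧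
      ∀ ε δ : ℝ, 0 < ε → ε < 1 / 2 → 0 < δ → δ < 1 / 10 →
        ∃ t : ℕ, 0 < t ∧ (t : ℝ) ≤ C * Real.log (1 / δ) ^ 5 / ε ^ 6 ∧
          ∀ n : ℕ, c * Real.log (1 / δ) ^ 10 / ε ^ 10 ≤ (n : ℝ) →
            ∃ A : LNDP.LocalAlgorithm n LNDP.Verdict,
              A.IsLNDP ε δ ∧
              LNDP.IsNoisyBitAlgorithm t A ∧
              2 / 3 ≤ LNDP.uniformAverage (LNDP.starpartiteGraphs n t)
                (fun G => A.outputProb G {LNDP.Verdict.starpartite}) ∧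
              2 / 3 ≤ LNDP.uniformAverage (LNDP.regularGraphs n t)
                (fun G => A.outputProb G {LNDP.Verdict.regular}) := by
  refine ⟨10 ^ 9, 10 ^ 11, by norm_num, by norm_num, fun ε δ hε hε2 hδ hδ10 => ?_⟩
  have hL : 2 ≤ Real.log (1 / δ) := by
    rw [Real.le_log_iff_exp_le (by positivity)]
    calc Real.exp 2 = Real.exp 1 ^ 2 := by rw [← Real.exp_nat_mul]; norm_num
      _ ≤ 3 ^ 2 := by gcongr; exact (Real.exp_one_lt_d9.trans (by norm_num)).le
      _ ≤ 1 / δ := by rw [le_div_iff₀ hδ]; linarith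
  set L := Real.log (1 / δ) with hLdef
  have hL0 : 0 < L := by linarith
  -- The variance of the averaged noise, the least value allowed by the privacy bound.
  set V : ℝ := 6 * L / ε ^ 2 with hVdef
  have hV48 : 48 ≤ V := by
    rw [hVdef, le_div_iff₀ (by positivity)]
    nlinarith
  have hV0 : 0 < V := by linarith
  set r := ⌈10 ^ 6 * V ^ 3⌉₊ with hr
  have hr0 : 0 < r := Nat.ceil_pos.2 (by positivity)
  have hrV : 10 ^ 6 * V ^ 3 ≤ r := Nat.le_ceil _
  have hr2 : (r : ℝ) ≤ 2 * 10 ^ 6 * V ^ 3 := by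
    have h1 := Nat.ceil_lt_add_one (show 0 ≤ 10 ^ 6 * V ^ 3 by positivity)
    have h2 : (1 : ℝ) ≤ V ^ 3 := one_le_pow₀ (by linarith)
    linarith
  have hV3 : V ^ 3 = 216 * L ^ 3 / ε ^ 6 := by
    rw [hVdef]
    field_simp
    norm_num
  -- The construction needs only the third power of `L`; the fifth power follows from `1 ≤ L`.
  have htL : ((2 * r : ℕ) : ℝ) ≤ 10 ^ 9 * L ^ 3 / ε ^ 6 := by
    rw [hV3] at hr2
    push_cast
    calc (2 : ℝ) * r ≤ 2 * (2 * 10 ^ 6 * (216 * L ^ 3 / ε ^ 6)) := by gcongr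
      _ = 864 * 10 ^ 6 * L ^ 3 / ε ^ 6 := by ring
      _ ≤ _ := by gcongr; norm_num
  refine ⟨2 * r, by omega, htL.trans ?_, fun n hn => ?_⟩
  · gcongr
    · linarith
    · norm_num
  -- The only use of the lower bound on `n`.
  have htn : 100 * (2 * r) ≤ n := by
    have h1 : (100 * (2 * r : ℕ) : ℝ) ≤ n := by
      refine le_trans ?_ hn
      calc (100 * (2 * r : ℕ) : ℝ) ≤ 100 * (10 ^ 9 * L ^ 3 / ε ^ 6) := by gcongr
        _ = 10 ^ 11 * L ^ 3 / ε ^ 6 := by ring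
        _ ≤ 10 ^ 11 * L ^ 10 / ε ^ 6 := by gcongr <;> [linarith; norm_num]
        _ ≤ 10 ^ 11 * L ^ 10 / ε ^ 10 := by
          refine div_le_div_of_nonneg_left (by positivity) (by positivity) ?_
          exact pow_le_pow_of_le_one hε.le (by linarith) (by norm_num)
    exact_mod_cast h1
  have hn0 : 0 < n := by omega
  have hn0' : (0 : ℝ) < n := by exact_mod_cast hn0
  obtain ⟨Pub, hPub, D, S, hD, hS, hdisj, hlaw⟩ := LNDP.exists_disjoint_uniform_multisets
    (m := n / (2 * r)) (s := 2 * r) hn0 (Nat.mul_div_le n (2 * r))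
  let σ : ℝ≥0 := NNReal.sqrt (n * V.toNNReal)
  have hσV : σ ^ 2 / n = V.toNNReal := by
    rw [NNReal.sq_sqrt, mul_div_cancel_left₀]
    exact_mod_cast hn0.ne'
  have hVc : ((σ ^ 2 / n : ℝ≥0) : ℝ) = V := by rw [hσV, Real.coe_toNNReal _ hV0.le]
  have hσ0 : 0 < σ := NNReal.sqrt_pos.2 (mul_pos (by exact_mod_cast hn0) (Real.toNNReal_pos.2 hV0))
  have hσ2 : (σ : ℝ) ^ 2 = n * V := by
    rw [← NNReal.coe_pow, NNReal.sq_sqrt, NNReal.coe_mul, Real.coe_toNNReal _ hV0.le]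
    simp
  have hv25 : 25 ≤ σ ^ 2 / (n : ℝ≥0) := by
    rw [← NNReal.coe_le_coe, hVc]
    norm_num
    linarith
  have hs : 10 ^ 6 * ((σ ^ 2 / n : ℝ≥0) : ℝ) ^ 3 ≤ (2 * r : ℕ) := by
    rw [hVc]
    push_cast
    linarith
  refine ⟨LNDP.noisyBitAlgorithm D S hS σ (LNDP.threshold (σ ^ 2 / n)), ?_,
    ⟨2 * r, Pub, hPub, D, hD, S, hS, σ, _, hσ0, hlaw, rfl⟩,
    LNDP.uniformAverage_ge (LNDP.starpartiteGraphs_nonempty (by omega)) fun G hG =>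
      LNDP.le_outputProb_starpartite D hS σ hn0 (by omega) htn hv25 hs hG,
    LNDP.uniformAverage_ge (LNDP.regularGraphs_nonempty (by omega)) fun G hG =>
      LNDP.le_outputProb_regular D σ hS hlaw (by omega) (by omega) htn
        (lt_of_lt_of_le (by norm_num) hv25).ne' hs hG⟩
  refine LNDP.isLNDP_noisyBitAlgorithm D hS _ hdisj hε (by linarith) hδ (by linarith) (by omega)
    hσ0 (le_of_eq ?_)
  rw [hσ2, hVdef, ← hLdef]
  field_simp
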